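/- Let $D=\{z\in\mathbb C:|z|<1\}$, $T=\{z\in\mathbb C:|z|=1\}$, and let $D(z_0,r)$ be the open disc of centre $z_0$ and radius $r$. For $k\in\{0,1,2,\dots\}\cup\{\infty\}$ let $C^k(T)$ be the space of functions $u:T\to\mathbb C$ for which $\theta\mapsto u(e^{i\theta})$ is $k$ times continuously differentiable on $\mathbb R$ (continuous if $k=0$, infinitely differentiable if $k=\infty$), with the topology defined by the seminorms $$\sup_{\theta\in\mathbb R}\left|\frac{d^l u(e^{i\theta})}{d\theta^l}\right|,\qquad l\in\mathbb{N}_0=\{0,1,2,\dots\},\ l\le k .$$ For $z_0\in T$ and $r>0$ put $\Omega(z_0,r)=D(z_0,r)\cap\{|z|>1\}$ and $P(z_0,r)=D(z_0,r)\cap D$. Define the following subsets of $C^k(T)$. - $U_2(T,k)$: all $u\in C^k(T)$ such that for no $z_0\in T$ and $r>0$ is there a continuous function $\lambda:T\cup\Omega(z_0,r)\to\mathbb C$, holomorphic in $\Omega(z_0,r)$, with $\lambda=u$ on $D(z_0,r)\cap T$. - $U_3(T,k)$: all $u\in C^k(T)$ such that for no $z_0\in T$ and $r>0$ is there a continuous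 function $h:T\cup P(z_0,r)\to\mathbb C$, holomorphic in $P(z_0,r)$, with $h=u$ on $D(z_0,r)\cap T$. - $U_4(T,k)$: all $u\in C^k(T)$ such that for no $z_0\in T$ and $r>0$ is there a function $\lambda$ as in the definition of $U_2(T,k)$ or a function $h$ as in the definition of $U_3(T,k)$. - $U_5(T,k)$: all $u\in C^k(T)$ such that for no $z_0\in T$ and $r>0$ is there a holomorphic function $f:D(z_0,r)\to\mathbb C$ with $f=u$ on $D(z_0,r)\cap T$. Theorem 3.18. For every $k=0,1,2,\dots$ or $\infty$, each of the classes $U_2(T,k)$, $U_3(T,k)$, $U_4(T,k)$, $U_5(T,k)$ is a dense $G_\delta$ subset of $C^k(T)$. -/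

import Mathlib

noncomputable section

namespace CircleExtension

/-- The function `θ ↦ u (e^{iθ})` on the real line. -/
def lift (u : Circle → ℂ) (θ : ℝ) : ℂ := u (Circle.exp θ)

theorem lift_add (u v : Circle → ℂ) : lift (u + v) = lift u + lift v := rfl

theorem lift_smul (c : ℂ) (u : Circle → ℂ) : lift (c • u) = c • lift u := rfl

/-- The functions `u : T → ℂ` that are `k` times continuously differentiable with respect to `θ`
(`k = 0, 1, 2, …` or `k = ∞`), as a linear subspace of the space of all functions on `T`. -/
def ckSubmodule (k : ℕ∞) : Submodule ℂ (Circle → ℂ) where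
  carrier := {u | ContDiff ℝ k (lift u)}
  add_mem' {u v} hu hv := by
    have hu' : ContDiff ℝ k (lift u) := hu
    have hv' : ContDiff ℝ k (lift v) := hv
    exact hu'.add hv'
  zero_mem' := by
    have h : ContDiff ℝ k (fun _ : ℝ => (0 : ℂ)) := contDiff_const
    exact h
  smul_mem' c u hu := by
    have hu' : ContDiff ℝ k (lift u) := hu
    exact hu'.const_smul c

/-- The space `C^k(T)`. This is a type of its own, so that it does not inherit the topology of
pointwise convergence from the space of all functions on `T`. -/
def Ck (k : ℕ∞) : Type := ↥(ckSubmodule k)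

instance (k : ℕ∞) : AddCommGroup (Ck k) := inferInstanceAs (AddCommGroup ↥(ckSubmodule k))

instance (k : ℕ∞) : Module ℂ (Ck k) := inferInstanceAs (Module ℂ ↥(ckSubmodule k))

instance (k : ℕ∞) : CoeFun (Ck k) (fun _ => Circle → ℂ) := ⟨fun u => u.1⟩

theorem Ck.contDiff {k : ℕ∞} (u : Ck k) : ContDiff ℝ k (lift u) := u.2

/-- `d^l u / dθ^l`, as a function of `θ`. -/
def angDeriv {k : ℕ∞} (l : ℕ) (u : Ck k) : ℝ → ℂ := iteratedDeriv l (lift u)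

theorem angDeriv_add {k : ℕ∞} {l : ℕ} (hl : (l : ℕ∞) ≤ k) (u v : Ck k) (θ : ℝ) :
    angDeriv l (u + v) θ = angDeriv l u θ + angDeriv l v θ := by
  have h : (l : WithTop ℕ∞) ≤ (k : WithTop ℕ∞) := by exact_mod_cast hl
  exact iteratedDeriv_add ((u.contDiff.of_le h).contDiffAt) ((v.contDiff.of_le h).contDiffAt)

theorem angDeriv_smul {k : ℕ∞} {l : ℕ} (hl : (l : ℕ∞) ≤ k) (c : ℂ) (u : Ck k) (θ : ℝ) :
    angDeriv l (c • u) θ = c • angDeriv l u θ := by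
  have h : (l : WithTop ℕ∞) ≤ (k : WithTop ℕ∞) := by exact_mod_cast hl
  exact iteratedDeriv_const_smul ((u.contDiff.of_le h).contDiffAt) c

theorem lift_periodic (u : Circle → ℂ) : Function.Periodic (lift u) (2 * Real.pi) := by
  intro θ
  simp [lift, Circle.exp_add]

theorem angDeriv_periodic {k : ℕ∞} (l : ℕ) (u : Ck k) :
    Function.Periodic (angDeriv l u) (2 * Real.pi) := by
  intro θ
  have h : (fun z => lift u (z + 2 * Real.pi)) = lift u := funext (lift_periodic u)
  have h2 := congrFun (iteratedDeriv_comp_add_const l (lift u) (2 * Real.pi)) θ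
  rw [h] at h2
  exact h2.symm

theorem angDeriv_continuous {k : ℕ∞} {l : ℕ} (hl : (l : ℕ∞) ≤ k) (u : Ck k) :
    Continuous (angDeriv l u) := by
  have h : (l : WithTop ℕ∞) ≤ (k : WithTop ℕ∞) := by exact_mod_cast hl
  exact u.contDiff.continuous_iteratedDeriv l h

theorem angDeriv_bddAbove {k : ℕ∞} {l : ℕ} (hl : (l : ℕ∞) ≤ k) (u : Ck k) :
    BddAbove (Set.range fun θ : ℝ => ‖angDeriv l u θ‖) := by
  have hc := (angDeriv_continuous hl u).norm
  have hp : Function.Periodic (fun θ => ‖angDeriv l u θ‖) (2 * Real.pi) := fun θ => by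
    simp only [angDeriv_periodic l u θ]
  exact (hp.compact_of_continuous Real.two_pi_pos.ne' hc).bddAbove

/-- The seminorm `sup_θ |d^l u / dθ^l|` on `C^k(T)`, for `l ≤ k`. -/
def ckSeminorm (k : ℕ∞) (l : {l : ℕ // (l : ℕ∞) ≤ k}) : Seminorm ℂ (Ck k) :=
  Seminorm.of (fun u => ⨆ θ : ℝ, ‖angDeriv l.1 u θ‖)
    (fun u v => ciSup_le fun θ => by
      rw [angDeriv_add l.2]
      exact (norm_add_le _ _).trans
        (add_le_add (le_ciSup (angDeriv_bddAbove l.2 u) θ) (le_ciSup (angDeriv_bddAbove l.2 v) θ)))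
    (fun c u => by
      simp only [angDeriv_smul l.2, norm_smul]
      exact (Real.mul_iSup_of_nonneg (norm_nonneg c) _).symm)

/-- The family of seminorms `sup_θ |d^l u / dθ^l|`, `l ∈ ℕ`, `l ≤ k`. -/
def ckSeminormFamily (k : ℕ∞) : SeminormFamily ℂ (Ck k) {l : ℕ // (l : ℕ∞) ≤ k} := ckSeminorm k

instance (k : ℕ∞) : Nonempty {l : ℕ // (l : ℕ∞) ≤ k} := ⟨⟨0, by simp⟩⟩

/-- The topology of `C^k(T)` is the one defined by the seminorms `sup_θ |d^l u / dθ^l|`,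
`l ∈ ℕ`, `l ≤ k`. -/
instance (k : ℕ∞) : TopologicalSpace (Ck k) :=
  (ckSeminormFamily k).moduleFilterBasis.topology

theorem withSeminorms (k : ℕ∞) : WithSeminorms (ckSeminormFamily k) := ⟨rfl⟩

/-- The unit circle as a subset of the plane. -/
def T : Set ℂ := Metric.sphere 0 1

/-- `D(z₀, r) ∩ {|z| > 1}`. -/
def outerPart (z₀ : Circle) (r : ℝ) : Set ℂ := Metric.ball (z₀ : ℂ) r ∩ {z | 1 < ‖z‖}

/-- `D(z₀, r) ∩ {|z| < 1}`. -/
def innerPart (z₀ : Circle) (r : ℝ) : Set ℂ := Metric.ball (z₀ : ℂ) r ∩ {z | ‖z‖ < 1}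

/-- `F` and `u` coincide on `D(z₀, r) ∩ T`. -/
def AgreeNear (F : ℂ → ℂ) (u : Circle → ℂ) (z₀ : Circle) (r : ℝ) : Prop :=
  ∀ z : Circle, (z : ℂ) ∈ Metric.ball (z₀ : ℂ) r → F z = u z

/-- `u` has a holomorphic extension from the exterior side at `z₀`. -/
def ExtendsOutside (u : Circle → ℂ) (z₀ : Circle) : Prop :=
  ∃ r : ℝ, 0 < r ∧ ∃ F : ℂ → ℂ, ContinuousOn F (T ∪ outerPart z₀ r) ∧
    DifferentiableOn ℂ F (outerPart z₀ r) ∧ AgreeNear F u z₀ r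

/-- `u` has a holomorphic extension from the interior side at `z₀`. -/
def ExtendsInside (u : Circle → ℂ) (z₀ : Circle) : Prop :=
  ∃ r : ℝ, 0 < r ∧ ∃ F : ℂ → ℂ, ContinuousOn F (T ∪ innerPart z₀ r) ∧
    DifferentiableOn ℂ F (innerPart z₀ r) ∧ AgreeNear F u z₀ r

/-- `u` is, near `z₀`, the restriction of a holomorphic function on a disc centred at `z₀`. -/
def ExtendsToDisc (u : Circle → ℂ) (z₀ : Circle) : Prop :=
  ∃ r : ℝ, 0 < r ∧ ∃ F : ℂ → ℂ, DifferentiableOn ℂ F (Metric.ball (z₀ : ℂ) r) ∧ AgreeNear F u z₀ r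

/-- The class `U₂(T, z₀, k)`. -/
def U2At (k : ℕ∞) (z₀ : Circle) : Set (Ck k) := {u | ¬ ExtendsOutside u z₀}

/-- The class `U₃(T, z₀, k)`. -/
def U3At (k : ℕ∞) (z₀ : Circle) : Set (Ck k) := {u | ¬ ExtendsInside u z₀}

/-- The class `U₄(T, z₀, k)`. -/
def U4At (k : ℕ∞) (z₀ : Circle) : Set (Ck k) :=
  {u | ¬ ExtendsOutside u z₀ ∧ ¬ ExtendsInside u z₀}

/-- The class `U₅(T, z₀, k)`. -/
def U5At (k : ℕ∞) (z₀ : Circle) : Set (Ck k) := {u | ¬ ExtendsToDisc u z₀}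

/-- The class `U₂(T, k)`. -/
def U2 (k : ℕ∞) : Set (Ck k) := ⋂ z₀ : Circle, U2At k z₀

/-- The class `U₃(T, k)`. -/
def U3 (k : ℕ∞) : Set (Ck k) := ⋂ z₀ : Circle, U3At k z₀

/-- The class `U₄(T, k)`. -/
def U4 (k : ℕ∞) : Set (Ck k) := ⋂ z₀ : Circle, U4At k z₀

/-- The class `U₅(T, k)`. -/
def U5 (k : ℕ∞) : Set (Ck k) := ⋂ z₀ : Circle, U5At k z₀

end CircleExtension

end

noncomputable section

namespace CircleExtension

open Metric Set Filter Topology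
open scoped BoundedContinuousFunction

/-! The heart is a quantitative uniqueness principle: a holomorphic function on `P(z₀, r)`, bounded
by `M` and sufficiently small on the arc, is small near `z₀`, with constants independent of the
function (`exists_small_of_small_on_arc_inner`). Hence if `u` is a uniform limit of functions with
extensions bounded by a common `M`, these extensions are uniformly Cauchy near `z₀`, and `u` itself
extends to a smaller neighbourhood.

So the closure of each class of functions with an extension bounded by `M` lies in the linear space
of functions extending to a smaller radius. That space is proper, since it omits `1/(z - p)` for a
pole `p` in the region, so it has empty interior. Letting centres run over a dense sequence, radii
over a null sequence and `M` over the naturals, `U3` becomes a countable intersection of dense open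
sets, and `C^k(T)` is a Baire space.

`U2` is the image of `U3` under `z ↦ 1/z`, `U4 = U2 ∩ U3`, and `U5` contains `U3`; that `U5` is a Gδ
follows from the same closure argument on full discs. -/

/-- The part of the closed unit disc in `D(z₀, r)`. -/
def closedPart (z₀ : Circle) (r : ℝ) : Set ℂ := closedBall 0 1 ∩ ball (z₀ : ℂ) r

theorem innerPart_subset_closedPart (z₀ : Circle) (r : ℝ) : innerPart z₀ r ⊆ closedPart z₀ r := by
  rintro z ⟨hz, hz1⟩
  exact ⟨by simpa using (le_of_lt hz1), hz⟩

theorem isOpen_innerPart (z₀ : Circle) (r : ℝ) : IsOpen (innerPart z₀ r) :=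
  isOpen_ball.inter (isOpen_lt continuous_norm continuous_const)

theorem convex_innerPart (z₀ : Circle) (r : ℝ) : Convex ℝ (innerPart z₀ r) := by
  refine (convex_ball _ _).inter ?_
  have : {z : ℂ | ‖z‖ < 1} = ball 0 1 := by ext z; simp
  rw [this]
  exact convex_ball _ _

theorem closedPart_mono {z₀ z₁ : Circle} {r s : ℝ} (h : ball (z₀ : ℂ) r ⊆ ball (z₁ : ℂ) s) :
    closedPart z₀ r ⊆ closedPart z₁ s := inter_subset_inter_right _ h

theorem innerPart_mono {z₀ z₁ : Circle} {r s : ℝ} (h : ball (z₀ : ℂ) r ⊆ ball (z₁ : ℂ) s) :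
    innerPart z₀ r ⊆ innerPart z₁ s := inter_subset_inter_left _ h

/-! ### Propagation of smallness from an arc -/

theorem norm_sub_circle_sq (z₀ : Circle) (z : ℂ) :
    ‖z - z₀‖ ^ 2 = ‖z‖ ^ 2 + 1 - 2 * (z * (starRingEnd ℂ) (z₀ : ℂ)).re := by
  have h := Complex.normSq_sub z (z₀ : ℂ)
  have h0 : Complex.normSq (z₀ : ℂ) = 1 := Circle.normSq_coe z₀
  rw [Complex.normSq_eq_norm_sq, Complex.normSq_eq_norm_sq z, h0] at h
  exact h

theorem re_ge_of_mem_ball {z₀ : Circle} {z : ℂ} {ρ : ℝ} (hz : z ∈ ball (z₀ : ℂ) ρ) :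
    1 - ρ ≤ (z * (starRingEnd ℂ) (z₀ : ℂ)).re := by
  have h1 : (z * (starRingEnd ℂ) (z₀ : ℂ)) = 1 + (z - z₀) * (starRingEnd ℂ) (z₀ : ℂ) := by
    have h0 : (z₀ : ℂ) * (starRingEnd ℂ) (z₀ : ℂ) = 1 := by
      rw [Complex.mul_conj, Circle.normSq_coe]; simp
    linear_combination h0
  have h2 : |((z - z₀) * (starRingEnd ℂ) (z₀ : ℂ)).re| ≤ ‖z - z₀‖ := by
    refine (Complex.abs_re_le_norm _).trans ?_
    rw [norm_mul, RCLike.norm_conj, Circle.norm_coe, mul_one]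
  rw [h1]
  have h3 := (abs_le.1 h2).1
  rw [mem_ball, dist_eq_norm] at hz
  simp only [Complex.add_re, Complex.one_re]
  linarith

/-- The radius of the disc about `z₀` on which smallness on the arc `D(z₀, r) ∩ T` propagates to the inside. -/
def shrink (r : ℝ) : ℝ := min (r ^ 2 / 8) r

theorem shrink_pos {r : ℝ} (hr : 0 < r) : 0 < shrink r := lt_min (by positivity) hr

theorem shrink_le (r : ℝ) : shrink r ≤ r := min_le_right _ _

/-- A bounded holomorphic function in `P(z₀, r)` which is small on the arc `D(z₀, r) ∩ T` is small
near `z₀`, uniformly with respect to the function. -/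
theorem exists_small_of_small_on_arc_inner {r : ℝ} (hr : 0 < r) (M : ℝ) {ε : ℝ} (hε : 0 < ε) :
    ∃ δ : ℝ, 0 < δ ∧ ∀ (z₀ : Circle) (F : ℂ → ℂ), ContinuousOn F (closedPart z₀ r) →
      DifferentiableOn ℂ F (innerPart z₀ r) → (∀ z ∈ closedPart z₀ r, ‖F z‖ ≤ M) →
      (∀ z : Circle, (z : ℂ) ∈ ball (z₀ : ℂ) r → ‖F z‖ ≤ δ) →
      ∀ z ∈ closedPart z₀ (shrink r), ‖F z‖ ≤ ε := by
  -- In the closed unit disc, `Re (w * conj z₀) ≥ 1 - d` forces `‖w - z₀‖² ≤ 2d < r²`, so this cap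
  -- lies in `D(z₀, r)`. The radius `shrink r ≤ d / 2` puts the target points in the half-depth cap
  -- `Re ≥ 1 - d / 2`.
  set d : ℝ := r ^ 2 / 4 with hd
  have hd0 : 0 < d := by positivity
  obtain ⟨N, hN0, hN⟩ : ∃ N : ℝ, 0 ≤ N ∧ M * Real.exp (-(N * (d / 2))) ≤ ε := by
    have h1 : Tendsto (fun N : ℝ => M * Real.exp (-(N * (d / 2)))) atTop (𝓝 (M * 0)) := by
      refine Tendsto.const_mul _ (Real.tendsto_exp_neg_atTop_nhds_zero.comp ?_)
      exact tendsto_id.atTop_mul_const (by positivity)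
    rw [mul_zero] at h1
    obtain ⟨N, h2, h3⟩ := ((h1.eventually (gt_mem_nhds hε)).and (eventually_ge_atTop 0)).exists
    exact ⟨N, h3, h2.le⟩
  have hexp1 : Real.exp (-(N * (d / 2))) ≤ 1 := Real.exp_le_one_iff.2 (by
    have := mul_nonneg hN0 (half_pos hd0).le; linarith)
  refine ⟨ε * Real.exp (-(N * (d / 2))), by positivity, ?_⟩
  intro z₀ F hFc hFd hM hδ z hz
  set c : ℂ := (starRingEnd ℂ) (z₀ : ℂ) with hc
  have key : ∀ w : ℂ, ‖w‖ ≤ 1 → 1 - d ≤ (w * c).re → w ∈ ball (z₀ : ℂ) r := by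
    intro w hw1 hw2
    rw [mem_ball, dist_eq_norm]
    have h1 := norm_sub_circle_sq z₀ w
    have h2 : ‖w‖ ^ 2 ≤ 1 := pow_le_one₀ (norm_nonneg _) hw1
    refine lt_of_pow_lt_pow_left₀ 2 hr.le ?_
    nlinarith
  have harc : ∀ w : ℂ, ‖w‖ = 1 → w ∈ ball (z₀ : ℂ) r →
      ‖F w‖ ≤ ε * Real.exp (-(N * (d / 2))) := by
    intro w hw hwr
    exact hδ ⟨w, mem_sphere_zero_iff_norm.2 hw⟩ hwr
  have hz1 : ‖z‖ ≤ 1 := by simpa using hz.1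
  rcases hz1.eq_or_lt with hz1 | hz1
  · exact (harc z hz1 (ball_subset_ball (shrink_le r) hz.2)).trans
      (mul_le_of_le_one_right hε.le hexp1)
  have hzx : 1 - d / 2 ≤ (z * c).re := by
    have := re_ge_of_mem_ball (ball_subset_ball (min_le_left _ _) hz.2)
    rw [hd]; linarith
  let U : Set ℂ := {w | ‖w‖ < 1} ∩ {w | 1 - d < (w * c).re}
  have hUo : IsOpen U := (isOpen_lt continuous_norm continuous_const).inter
    (isOpen_lt continuous_const (by fun_prop))
  have hUcl : closure U ⊆ {w | ‖w‖ ≤ 1} ∩ {w | 1 - d ≤ (w * c).re} := by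
    refine closure_minimal (fun w hw => ⟨hw.1.out.le, hw.2.out.le⟩) ?_
    exact (isClosed_le continuous_norm continuous_const).inter
      (isClosed_le continuous_const (by fun_prop))
  have hUcp : closure U ⊆ closedPart z₀ r := fun w hw =>
    ⟨by simpa using (hUcl hw).1, key w (hUcl hw).1 (hUcl hw).2⟩
  -- The exponential weight makes the chord `Re (w * c) = 1 - d` negligible compared with depth `d /
  -- 2`. There the crude bound `M` suffices for large `N`; on the arc the choice of `δ` compensates
  -- for the weight, which is at most `exp N`.
  let G : ℂ → ℂ := fun w => F w * Complex.exp (N * (w * c))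
  have hGn : ∀ w, ‖G w‖ = ‖F w‖ * Real.exp (N * (w * c).re) := by
    intro w
    simp only [G, norm_mul, Complex.norm_exp, Complex.re_ofReal_mul]
  have hUi : U ⊆ innerPart z₀ r := fun w hw => ⟨key w hw.1.out.le hw.2.out.le, hw.1⟩
  have hGd : DiffContOnCl ℂ G U := by
    refine ⟨(hFd.mono hUi).mul (by fun_prop), (hFc.mono hUcp).mul (by fun_prop)⟩
  have hUb : Bornology.IsBounded U := by
    refine (isBounded_ball (x := (0 : ℂ)) (r := 1)).subset fun w hw => ?_
    simpa using hw.1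
  have hfr : ∀ w ∈ frontier U, ‖G w‖ ≤ ε * Real.exp (N * (1 - d / 2)) := by
    intro w hw
    rw [hUo.frontier_eq] at hw
    obtain ⟨hw1, hw2⟩ := hw
    have hwc := hUcl hw1
    rw [hGn]
    have hre : (w * c).re ≤ 1 := by
      refine (Complex.re_le_norm _).trans ?_
      rw [norm_mul, hc, RCLike.norm_conj, Circle.norm_coe, mul_one]
      exact hwc.1
    rcases (show ‖w‖ ≤ 1 from hwc.1).eq_or_lt with h | h
    · calc ‖F w‖ * Real.exp (N * (w * c).re)
          ≤ (ε * Real.exp (-(N * (d / 2)))) * Real.exp (N * 1) := by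
            gcongr
            exact harc w h (hUcp hw1).2
        _ = ε * Real.exp (N * (1 - d / 2)) := by
            rw [mul_assoc, ← Real.exp_add]; ring_nf
    · have hx : (w * c).re = 1 - d := by
        refine le_antisymm ?_ hwc.2
        by_contra hlt
        exact hw2 ⟨h, not_le.1 hlt⟩
      rw [hx]
      calc ‖F w‖ * Real.exp (N * (1 - d)) ≤ M * Real.exp (N * (1 - d)) := by
            gcongr
            exact hM w (hUcp hw1)
        _ = (M * Real.exp (-(N * (d / 2)))) * Real.exp (N * (1 - d / 2)) := by
            rw [mul_assoc, ← Real.exp_add]; ring_nf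
        _ ≤ ε * Real.exp (N * (1 - d / 2)) := by gcongr
  have hzU : z ∈ U := ⟨hz1, by
    change 1 - d < (z * c).re
    linarith⟩
  have hfin := Complex.norm_le_of_forall_mem_frontier_norm_le hUb hGd hfr (subset_closure hzU)
  rw [hGn] at hfin
  have h5 : ‖F z‖ * Real.exp (N * (1 - d / 2)) ≤ ε * Real.exp (N * (1 - d / 2)) := by
    refine le_trans ?_ hfin
    gcongr
  exact le_of_mul_le_mul_right h5 (Real.exp_pos _)

theorem dist_sq_div {z₀ : Circle} {w : ℂ} (hw : w ≠ 0) :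
    ‖(z₀ : ℂ) ^ 2 / w - z₀‖ = ‖w - z₀‖ / ‖w‖ := by
  have h : (z₀ : ℂ) ^ 2 / w - z₀ = z₀ * (z₀ - w) / w := by field_simp
  rw [h, norm_div, norm_mul, Circle.norm_coe, one_mul, norm_sub_rev]

theorem norm_sq_div {z₀ : Circle} {w : ℂ} : ‖(z₀ : ℂ) ^ 2 / w‖ = ‖w‖⁻¹ := by
  rw [norm_div, norm_pow, Circle.norm_coe]; simp

theorem half_lt_norm {z₀ : Circle} {w : ℂ} {r : ℝ} (hr : r ≤ 1 / 2) (hw : w ∈ ball (z₀ : ℂ) r) :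
    1 / 2 < ‖w‖ := by
  rw [mem_ball, dist_eq_norm] at hw
  have h1 : ‖(z₀ : ℂ)‖ ≤ ‖w‖ + ‖w - z₀‖ := by
    rw [norm_sub_rev]
    calc ‖(z₀ : ℂ)‖ = ‖w + (z₀ - w)‖ := by congr 1; ring
      _ ≤ _ := norm_add_le _ _
  rw [Circle.norm_coe] at h1
  linarith

/-- Points outside the unit disc are handled by applying the one-sided estimate to `F (z₀² / w)`:
this inversion fixes `z₀`, preserves the circle and exchanges its sides. It at most doubles
distances to `z₀` where `‖w‖ > 1 / 2`, whence the radius `2 * r` in the hypotheses. -/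
theorem exists_small_of_small_on_arc_disc {r : ℝ} (hr : 0 < r) (hr' : r ≤ 1 / 2) (M : ℝ) {ε : ℝ}
    (hε : 0 < ε) :
    ∃ δ : ℝ, 0 < δ ∧ ∀ (z₀ : Circle) (F : ℂ → ℂ),
      DifferentiableOn ℂ F (ball (z₀ : ℂ) (2 * r)) →
      (∀ z ∈ ball (z₀ : ℂ) (2 * r), ‖F z‖ ≤ M) →
      (∀ z : Circle, (z : ℂ) ∈ ball (z₀ : ℂ) (2 * r) → ‖F z‖ ≤ δ) →
      ∀ z ∈ ball (z₀ : ℂ) (shrink r), ‖F z‖ ≤ ε := by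
  obtain ⟨δ, hδ, h⟩ := exists_small_of_small_on_arc_inner hr M hε
  refine ⟨δ, hδ, fun z₀ F hF hM hs z hz => ?_⟩
  have hsub : ball (z₀ : ℂ) r ⊆ ball (z₀ : ℂ) (2 * r) := ball_subset_ball (by linarith)
  rcases le_or_gt ‖z‖ 1 with hz1 | hz1
  · exact h z₀ F (hF.continuousOn.mono (inter_subset_right.trans hsub))
      (hF.mono (inter_subset_left.trans hsub)) (fun w hw => hM w (hsub hw.2))
      (fun w hw => hs w (hsub hw)) z ⟨by simpa using hz1, hz⟩
  · have hne : ∀ w ∈ ball (z₀ : ℂ) r, w ≠ 0 := fun w hw h0 => by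
      have := half_lt_norm hr' hw
      rw [h0, norm_zero] at this
      linarith
    have hmaps : ∀ w ∈ ball (z₀ : ℂ) r, (z₀ : ℂ) ^ 2 / w ∈ ball (z₀ : ℂ) (2 * r) := by
      intro w hw
      have h2 := half_lt_norm hr' hw
      rw [mem_ball, dist_eq_norm, dist_sq_div (hne w hw), div_lt_iff₀ (by linarith)]
      rw [mem_ball, dist_eq_norm] at hw
      nlinarith
    have hGd : DifferentiableOn ℂ (fun w => F ((z₀ : ℂ) ^ 2 / w)) (ball (z₀ : ℂ) r) :=
      hF.comp (fun w hw => ((differentiableAt_const _).div differentiableAt_id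
        (hne w hw)).differentiableWithinAt) hmaps
    have hz0 : z ≠ 0 := fun h0 => by rw [h0, norm_zero] at hz1; linarith
    have hfin := h z₀ (fun w => F ((z₀ : ℂ) ^ 2 / w))
      (hGd.continuousOn.mono inter_subset_right) (hGd.mono inter_subset_left)
      (fun w hw => hM _ (hmaps w hw.2)) (fun w hw => by
        have := hs (z₀ ^ 2 / w) (by simpa using hmaps w hw)
        simpa using this) ((z₀ : ℂ) ^ 2 / z) ⟨?_, ?_⟩
    · have h3 : (z₀ : ℂ) ^ 2 / ((z₀ : ℂ) ^ 2 / z) = z := by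
        have := Circle.coe_ne_zero z₀
        field_simp
      simpa only [h3] using hfin
    · rw [mem_closedBall_zero_iff, norm_sq_div]
      exact inv_le_one_of_one_le₀ hz1.le
    · rw [mem_ball, dist_eq_norm] at hz ⊢
      rw [dist_sq_div hz0]
      exact (div_le_self (norm_nonneg _) hz1.le).trans_lt hz

/-! ### Limits of bounded extensions -/

/-- A sequence of functions from a class on which smallness on the arc `D(z₀, r) ∩ T` implies
smallness on `S` converges uniformly on `S` as soon as it converges uniformly on the arc. -/
theorem exists_tendstoUniformlyOn {P : (ℂ → ℂ) → Prop} {S : Set ℂ} {z₀ : Circle} {r : ℝ}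
    {u : Circle → ℂ}
    (hP : ∀ ε : ℝ, 0 < ε → ∃ δ : ℝ, 0 < δ ∧ ∀ F G : ℂ → ℂ, P F → P G →
      (∀ z : Circle, (z : ℂ) ∈ ball (z₀ : ℂ) r → ‖F z - G z‖ ≤ δ) → ∀ z ∈ S, ‖F z - G z‖ ≤ ε)
    (hu : ∀ ε : ℝ, 0 < ε → ∃ F, P F ∧
      ∀ z : Circle, (z : ℂ) ∈ ball (z₀ : ℂ) r → ‖F z - u z‖ ≤ ε) :
    ∃ (F : ℕ → ℂ → ℂ) (G : ℂ → ℂ), (∀ n, P (F n)) ∧ TendstoUniformlyOn F G atTop S ∧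
      ∀ z : Circle, (z : ℂ) ∈ ball (z₀ : ℂ) r → (z : ℂ) ∈ S → G z = u z := by
  choose F hF hFu using fun n : ℕ => hu (1 / ((n : ℝ) + 1)) Nat.one_div_pos_of_nat
  have hlim := tendsto_one_div_add_atTop_nhds_zero_nat (𝕜 := ℝ)
  have hC : UniformCauchySeqOn F atTop S := by
    rw [Metric.uniformCauchySeqOn_iff]
    intro ε hε
    obtain ⟨δ, hδ, h⟩ := hP (ε / 2) (half_pos hε)
    obtain ⟨N, hN⟩ := eventually_atTop.1 (hlim.eventually (gt_mem_nhds (half_pos hδ)))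
    refine ⟨N, fun m hm n hn z hz => ?_⟩
    rw [dist_eq_norm]
    refine (h _ _ (hF m) (hF n) (fun w hw => ?_) z hz).trans_lt (half_lt_self hε)
    have h1 := hFu m w hw
    have h2 := hFu n w hw
    have h3 := hN m hm
    have h4 := hN n hn
    calc ‖F m w - F n w‖ = ‖(F m w - u w) - (F n w - u w)‖ := by congr 1; ring
      _ ≤ ‖F m w - u w‖ + ‖F n w - u w‖ := norm_sub_le _ _
      _ ≤ δ := by linarith
  have hlimG : ∀ z : ℂ, ∃ g : ℂ, z ∈ S → Tendsto (fun n => F n z) atTop (𝓝 g) := by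
    intro z
    by_cases hz : z ∈ S
    · obtain ⟨g, hg⟩ := cauchySeq_tendsto_of_complete (hC.cauchySeq hz)
      exact ⟨g, fun _ => hg⟩
    · exact ⟨0, fun h => absurd h hz⟩
  choose G hG using hlimG
  refine ⟨F, G, hF, hC.tendstoUniformlyOn_of_tendsto fun z hz => hG z hz, fun z hz hzS => ?_⟩
  refine tendsto_nhds_unique (hG z hzS) ?_
  rw [tendsto_iff_norm_sub_tendsto_zero]
  exact squeeze_zero (fun _ => norm_nonneg _) (fun n => hFu n z hz) hlim

/-- `F` is a holomorphic extension of `u` to `P(z₀, r)`, continuous up to `D(z₀, r) ∩ T`. -/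
def IsInnerExt (F : ℂ → ℂ) (u : Circle → ℂ) (z₀ : Circle) (r : ℝ) : Prop :=
  ContinuousOn F (closedPart z₀ r) ∧ DifferentiableOn ℂ F (innerPart z₀ r) ∧ AgreeNear F u z₀ r

/-- `F` is a holomorphic extension of `u` to `D(z₀, r)`. -/
def IsDiscExt (F : ℂ → ℂ) (u : Circle → ℂ) (z₀ : Circle) (r : ℝ) : Prop :=
  DifferentiableOn ℂ F (ball (z₀ : ℂ) r) ∧ AgreeNear F u z₀ r

theorem IsInnerExt.mono {F : ℂ → ℂ} {u : Circle → ℂ} {z₀ z₁ : Circle} {r s : ℝ}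
    (hF : IsInnerExt F u z₁ s) (h : ball (z₀ : ℂ) r ⊆ ball (z₁ : ℂ) s) : IsInnerExt F u z₀ r :=
  ⟨hF.1.mono (closedPart_mono h), hF.2.1.mono (innerPart_mono h), fun z hz => hF.2.2 z (h hz)⟩

theorem IsDiscExt.mono {F : ℂ → ℂ} {u : Circle → ℂ} {z₀ z₁ : Circle} {r s : ℝ}
    (hF : IsDiscExt F u z₁ s) (h : ball (z₀ : ℂ) r ⊆ ball (z₁ : ℂ) s) : IsDiscExt F u z₀ r :=
  ⟨hF.1.mono h, fun z hz => hF.2 z (h hz)⟩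

theorem IsDiscExt.isInnerExt {F : ℂ → ℂ} {u : Circle → ℂ} {z₀ : Circle} {r : ℝ}
    (hF : IsDiscExt F u z₀ r) : IsInnerExt F u z₀ r :=
  ⟨hF.1.continuousOn.mono inter_subset_right, hF.1.mono inter_subset_left, hF.2⟩

/-- Continuity on all of `T` costs nothing: after halving the radius, Tietze's theorem extends `F`
from a closed set to the plane, and no agreement with `u` is required away from `z₀`. -/
theorem extendsInside_iff {u : Circle → ℂ} {z₀ : Circle} :
    ExtendsInside u z₀ ↔ ∃ r : ℝ, 0 < r ∧ ∃ F, IsInnerExt F u z₀ r := by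
  constructor
  · rintro ⟨r, hr, F, hFc, hFd, hFu⟩
    refine ⟨r, hr, F, hFc.mono ?_, hFd, hFu⟩
    rintro z ⟨hz1, hz2⟩
    rcases (mem_closedBall_zero_iff.1 hz1).eq_or_lt with h | h
    · exact Or.inl (mem_sphere_zero_iff_norm.2 h)
    · exact Or.inr ⟨hz2, h⟩
  · rintro ⟨r, hr, F, hFc, hFd, hFu⟩
    set K : Set ℂ := closedBall 0 1 ∩ closedBall (z₀ : ℂ) (r / 2)
    have hK : IsClosed K := isClosed_closedBall.inter isClosed_closedBall
    have hKs : K ⊆ closedPart z₀ r :=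
      inter_subset_inter_right _ (closedBall_subset_ball (half_lt_self hr))
    obtain ⟨G, hG⟩ := ContinuousMap.exists_restrict_eq hK
      ⟨K.domRestrict F, (hFc.mono hKs).domRestrict⟩
    have hGF : ∀ z ∈ K, G z = F z := fun z hz => congrArg (fun f => f ⟨z, hz⟩) hG
    have hsub : ball (z₀ : ℂ) (r / 2) ⊆ ball (z₀ : ℂ) r := ball_subset_ball (by linarith)
    refine ⟨r / 2, half_pos hr, G, G.continuous.continuousOn, ?_, fun z hz => ?_⟩
    · refine (hFd.mono (innerPart_mono hsub)).congr fun z hz => hGF z ?_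
      exact ⟨(innerPart_subset_closedPart _ _ hz).1, ball_subset_closedBall hz.1⟩
    · rw [← hFu z (hsub hz)]
      exact hGF z ⟨by simp [Circle.norm_coe], ball_subset_closedBall hz⟩

theorem ExtendsToDisc.extendsInside {u : Circle → ℂ} {z₀ : Circle} (h : ExtendsToDisc u z₀) :
    ExtendsInside u z₀ := by
  obtain ⟨r, hr, F, hF⟩ := h
  exact extendsInside_iff.2 ⟨r, hr, F, IsDiscExt.isInnerExt hF⟩

/-- Differences of the extensions are bounded by `2M` and small on the arc, so propagation of
smallness makes them uniformly Cauchy up to the boundary. The limit is holomorphic inside and has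
boundary values `u`. -/
theorem exists_isInnerExt_of_approx {u : Circle → ℂ} {z₀ : Circle} {r M : ℝ} (hr : 0 < r)
    (hu : ∀ ε : ℝ, 0 < ε → ∃ (v : Circle → ℂ) (F : ℂ → ℂ), IsInnerExt F v z₀ r ∧
      (∀ z ∈ closedPart z₀ r, ‖F z‖ ≤ M) ∧ ∀ z, ‖v z - u z‖ ≤ ε) :
    ∃ G, IsInnerExt G u z₀ (shrink r) := by
  obtain ⟨F, G, hF, hFG, hG⟩ := exists_tendstoUniformlyOn (u := u) (z₀ := z₀) (r := r)
    (P := fun F => (∃ v, IsInnerExt F v z₀ r) ∧ ∀ z ∈ closedPart z₀ r, ‖F z‖ ≤ M)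
    (S := closedPart z₀ (shrink r)) (fun ε hε => by
      obtain ⟨δ, hδ, h⟩ := exists_small_of_small_on_arc_inner hr (M + M) hε
      refine ⟨δ, hδ, fun F G hF hG hFG => ?_⟩
      obtain ⟨⟨v, hF⟩, hFM⟩ := hF
      obtain ⟨⟨w, hG⟩, hGM⟩ := hG
      exact h z₀ (fun z => F z - G z) (hF.1.sub hG.1) (hF.2.1.sub hG.2.1)
        (fun z hz => (norm_sub_le _ _).trans (add_le_add (hFM z hz) (hGM z hz))) hFG)
    (fun ε hε => by
      obtain ⟨v, F, hF, hFM, hv⟩ := hu ε hε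
      exact ⟨F, ⟨⟨v, hF⟩, hFM⟩, fun z hz => by rw [hF.2.2 z hz]; exact hv z⟩)
  have hsub : ball (z₀ : ℂ) (shrink r) ⊆ ball (z₀ : ℂ) r := ball_subset_ball (shrink_le r)
  refine ⟨G, ?_, ?_, fun z hz => hG z (hsub hz) ⟨by simp [Circle.norm_coe], hz⟩⟩
  · refine hFG.continuousOn (Eventually.frequently (Eventually.of_forall fun n => ?_))
    obtain ⟨⟨v, h⟩, -⟩ := hF n
    exact h.1.mono (closedPart_mono hsub)
  · refine (hFG.mono (innerPart_subset_closedPart _ _)).tendstoLocallyUniformlyOn.differentiableOn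
      (Eventually.of_forall fun n => ?_) (isOpen_innerPart _ _)
    obtain ⟨⟨v, h⟩, -⟩ := hF n
    exact h.2.1.mono (innerPart_mono hsub)

theorem exists_isDiscExt_of_approx {u : Circle → ℂ} {z₀ : Circle} {r M : ℝ} (hr : 0 < r)
    (hr' : r ≤ 1 / 2)
    (hu : ∀ ε : ℝ, 0 < ε → ∃ (v : Circle → ℂ) (F : ℂ → ℂ), IsDiscExt F v z₀ (2 * r) ∧
      (∀ z ∈ ball (z₀ : ℂ) (2 * r), ‖F z‖ ≤ M) ∧ ∀ z, ‖v z - u z‖ ≤ ε) :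
    ∃ G, IsDiscExt G u z₀ (shrink r) := by
  obtain ⟨F, G, hF, hFG, hG⟩ := exists_tendstoUniformlyOn (u := u) (z₀ := z₀) (r := 2 * r)
    (P := fun F => (∃ v, IsDiscExt F v z₀ (2 * r)) ∧ ∀ z ∈ ball (z₀ : ℂ) (2 * r), ‖F z‖ ≤ M)
    (S := ball (z₀ : ℂ) (shrink r)) (fun ε hε => by
      obtain ⟨δ, hδ, h⟩ := exists_small_of_small_on_arc_disc hr hr' (M + M) hε
      refine ⟨δ, hδ, fun F G hF hG hFG => ?_⟩
      obtain ⟨⟨v, hF⟩, hFM⟩ := hF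
      obtain ⟨⟨w, hG⟩, hGM⟩ := hG
      exact h z₀ (fun z => F z - G z) (hF.1.sub hG.1)
        (fun z hz => (norm_sub_le _ _).trans (add_le_add (hFM z hz) (hGM z hz))) hFG)
    (fun ε hε => by
      obtain ⟨v, F, hF, hFM, hv⟩ := hu ε hε
      exact ⟨F, ⟨⟨v, hF⟩, hFM⟩, fun z hz => by rw [hF.2 z hz]; exact hv z⟩)
  have hsub : ball (z₀ : ℂ) (shrink r) ⊆ ball (z₀ : ℂ) (2 * r) :=
    ball_subset_ball ((shrink_le r).trans (by linarith))
  refine ⟨G, ?_, fun z hz => hG z (hsub hz) hz⟩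
  refine hFG.tendstoLocallyUniformlyOn.differentiableOn
    (Eventually.of_forall fun n => ?_) isOpen_ball
  obtain ⟨⟨v, h⟩, -⟩ := hF n
  exact h.1.mono hsub

/-! ### Boundary uniqueness and a function without extension -/

theorem innerPart_nonempty (z₀ : Circle) {r : ℝ} (hr : 0 < r) : (innerPart z₀ r).Nonempty := by
  set t : ℝ := min (r / 2) (1 / 2)
  have ht0 : 0 < t := lt_min (half_pos hr) (by norm_num)
  have ht1 : t ≤ 1 / 2 := min_le_right _ _
  refine ⟨((1 - t : ℝ) : ℂ) * z₀, ?_, ?_⟩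
  · rw [mem_ball, dist_eq_norm]
    have : ((1 - t : ℝ) : ℂ) * z₀ - z₀ = ((-t : ℝ) : ℂ) * z₀ := by push_cast; ring
    rw [this, norm_mul, Circle.norm_coe, mul_one, Complex.norm_real, norm_neg,
      Real.norm_of_nonneg ht0.le]
    exact (min_le_left _ _).trans_lt (half_lt_self hr)
  · change ‖((1 - t : ℝ) : ℂ) * z₀‖ < 1
    rw [norm_mul, Circle.norm_coe, mul_one, Complex.norm_real, Real.norm_of_nonneg (by linarith)]
    linarith

/-- A function in `P(z₀, r)` with vanishing boundary values on the arc `D(z₀, r) ∩ T` is zero. -/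
theorem IsInnerExt.eq_zero {F : ℂ → ℂ} {z₀ : Circle} {r : ℝ} (hr : 0 < r)
    (hF : IsInnerExt F 0 z₀ r) {z : ℂ} (hz : z ∈ innerPart z₀ r) : F z = 0 := by
  set s := r / 2 with hs
  have hs0 : 0 < s := half_pos hr
  have hsub : ball (z₀ : ℂ) s ⊆ ball (z₀ : ℂ) r := ball_subset_ball (by linarith)
  have hK : IsCompact (closedBall (0 : ℂ) 1 ∩ closedBall (z₀ : ℂ) s) :=
    (isCompact_closedBall 0 1).inter_right isClosed_closedBall
  obtain ⟨M, hM⟩ := hK.exists_bound_of_continuousOn (hF.1.mono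
    (inter_subset_inter_right _ (closedBall_subset_ball (half_lt_self hr))))
  -- Zero boundary values meet the smallness condition for every `δ`, so `F` vanishes near `z₀`; the
  -- identity theorem then covers the convex region.
  have hsmall : ∀ w ∈ closedPart z₀ (shrink s), F w = 0 := by
    intro w hw
    refine norm_le_zero_iff.1 (le_of_forall_pos_le_add fun ε hε => ?_)
    obtain ⟨δ, hδ, h⟩ := exists_small_of_small_on_arc_inner hs0 M hε
    rw [zero_add]
    refine h z₀ F (hF.mono hsub).1 (hF.mono hsub).2.1
      (fun w hw => hM w ⟨hw.1, ball_subset_closedBall hw.2⟩) (fun w hw => ?_) w hw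
    rw [hF.2.2 w (hsub hw)]
    simpa using hδ.le
  obtain ⟨p, hp⟩ := innerPart_nonempty z₀ (shrink_pos hs0)
  have hev : F =ᶠ[𝓝 p] 0 := by
    filter_upwards [(isOpen_innerPart z₀ (shrink s)).mem_nhds hp] with w hw
    exact hsmall w (innerPart_subset_closedPart _ _ hw)
  have hpr := innerPart_mono ((ball_subset_ball (shrink_le s)).trans hsub) hp
  exact (hF.2.1.analyticOnNhd (isOpen_innerPart z₀ r)).eqOn_zero_of_preconnected_of_eventuallyEq_zero
    (convex_innerPart z₀ r).isPreconnected hpr hev hz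

/-- For an extension `F`, the function `(z - p) * F z - 1` would vanish on the arc, hence throughout
the region, but its value at `p` is `-1`. -/
theorem not_isInnerExt_inv_sub {F : ℂ → ℂ} {z₀ : Circle} {r : ℝ} (hr : 0 < r) {p : ℂ}
    (hp : p ∈ innerPart z₀ r) : ¬ IsInnerExt F (fun z => ((z : ℂ) - p)⁻¹) z₀ r := by
  rintro ⟨hFc, hFd, hFu⟩
  have h : IsInnerExt (fun z => (z - p) * F z - 1) 0 z₀ r := by
    refine ⟨by fun_prop, by fun_prop, fun z hz => ?_⟩
    have hne : (z : ℂ) - p ≠ 0 := fun h => by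
      have h1 : ‖p‖ < 1 := hp.2
      rw [← sub_eq_zero.1 h, Circle.norm_coe] at h1
      exact lt_irrefl _ h1
    simp [hFu z hz, hne]
  have := h.eq_zero hr hp
  simp at this

/-! ### `C^k(T)` is a Baire space -/

theorem Ck.ext {k : ℕ∞} {u v : Ck k} (h : ∀ z, u z = v z) : u = v := Subtype.ext (funext h)

theorem Ck.isTopologicalAddGroup (k : ℕ∞) : IsTopologicalAddGroup (Ck k) :=
  (withSeminorms k).topologicalAddGroup

theorem Ck.continuousSMul (k : ℕ∞) : ContinuousSMul ℂ (Ck k) :=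
  (withSeminorms k).continuousSMul

theorem ckSeminorm_apply {k : ℕ∞} (l : {l : ℕ // (l : ℕ∞) ≤ k}) (u : Ck k) :
    ckSeminormFamily k l u = ⨆ θ : ℝ, ‖angDeriv l.1 u θ‖ := rfl

theorem norm_apply_le_ckSeminorm {k : ℕ∞} (u : Ck k) (z : Circle) :
    ‖u z‖ ≤ ckSeminormFamily k ⟨0, by simp⟩ u := by
  obtain ⟨θ, rfl⟩ := Circle.exp_surjective z
  have h := le_ciSup (angDeriv_bddAbove (k := k) (l := 0) (by simp) u) θ
  rw [angDeriv, iteratedDeriv_zero] at h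
  exact h

theorem exists_mem_forall_norm_sub_le {k : ℕ∞} {S : Set (Ck k)} {u : Ck k} (hu : u ∈ closure S)
    {ε : ℝ} (hε : 0 < ε) : ∃ v ∈ S, ∀ z, ‖v z - u z‖ ≤ ε := by
  have := Ck.isTopologicalAddGroup k
  have hc : Continuous fun v : Ck k => ckSeminormFamily k ⟨0, by simp⟩ (v - u) :=
    ((withSeminorms k).continuous_seminorm _).comp (continuous_sub_right u)
  have hn : {v : Ck k | ckSeminormFamily k ⟨0, by simp⟩ (v - u) < ε} ∈ 𝓝 u :=
    (isOpen_lt hc continuous_const).mem_nhds (by simpa using hε)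
  obtain ⟨v, hv, hvS⟩ := mem_closure_iff_nhds.1 hu _ hn
  exact ⟨v, hvS, fun z => (norm_apply_le_ckSeminorm (v - u) z).trans hv.out.le⟩

/-- `d^l u / dθ^l`, as a bounded continuous function. -/
def angDerivBCF {k : ℕ∞} (l : {l : ℕ // (l : ℕ∞) ≤ k}) (u : Ck k) : ℝ →ᵇ ℂ :=
  BoundedContinuousFunction.ofNormedAddCommGroup (angDeriv l.1 u) (angDeriv_continuous l.2 u)
    (⨆ θ : ℝ, ‖angDeriv l.1 u θ‖) (fun θ => le_ciSup (angDeriv_bddAbove l.2 u) θ)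

theorem norm_angDerivBCF {k : ℕ∞} (l : {l : ℕ // (l : ℕ∞) ≤ k}) (u : Ck k) :
    ‖angDerivBCF l u‖ = ckSeminormFamily k l u := by
  rw [BoundedContinuousFunction.norm_eq_iSup_norm]
  rfl

/-- All derivatives of order at most `k`. -/
def jet (k : ℕ∞) : Ck k →+ ({l : ℕ // (l : ℕ∞) ≤ k} → (ℝ →ᵇ ℂ)) where
  toFun u l := angDerivBCF l u
  map_zero' := by
    funext l
    refine norm_eq_zero.1 ?_
    rw [norm_angDerivBCF, map_zero]
  map_add' u v := by
    funext l
    ext θ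
    exact angDeriv_add l.2 u v θ

theorem isInducing_jet (k : ℕ∞) : IsInducing (jet k) := by
  have := Ck.isTopologicalAddGroup k
  refine IsTopologicalAddGroup.isInducing_iff_nhds_zero.2 ?_
  rw [(ckSeminormFamily k).withSeminorms_iff_nhds_eq_iInf.1 (withSeminorms k), nhds_pi,
    Filter.pi, comap_iInf]
  refine iInf_congr fun l => ?_
  rw [comap_comap, Pi.zero_apply, ← comap_norm_nhds_zero (E := ℝ →ᵇ ℂ), comap_comap]
  congr 1
  funext u
  exact (norm_angDerivBCF l u).symm

theorem injective_jet (k : ℕ∞) : Function.Injective (jet k) := by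
  intro u v h
  refine Ck.ext fun z => ?_
  obtain ⟨θ, rfl⟩ := Circle.exp_surjective z
  have h1 := congrArg (fun f : ℝ →ᵇ ℂ => f θ) (congrFun h ⟨0, by simp⟩)
  simpa [jet, angDerivBCF, angDeriv, lift] using h1

theorem hasDerivAt_angDeriv {k : ℕ∞} (u : Ck k) {l : ℕ} (hl : ((l + 1 : ℕ) : ℕ∞) ≤ k) (θ : ℝ) :
    HasDerivAt (angDeriv l u) (angDeriv (l + 1) u θ) θ := by
  have h1 : ((l : ℕ) : WithTop ℕ∞) < (k : WithTop ℕ∞) := by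
    have : (l : ℕ∞) < k := lt_of_lt_of_le (by exact_mod_cast Nat.lt_succ_self l) hl
    exact_mod_cast this
  have h2 := (u.contDiff.differentiable_iteratedDeriv l h1 θ).hasDerivAt
  unfold angDeriv
  rwa [iteratedDeriv_succ]

/-- A compatible family of functions is the family of derivatives of an element of `C^k(T)`. -/
theorem exists_ck_of_hasDerivAt {k : ℕ∞} (g : {l : ℕ // (l : ℕ∞) ≤ k} → (ℝ →ᵇ ℂ))
    (hper : Function.Periodic (g ⟨0, by simp⟩) (2 * Real.pi))
    (hg : ∀ (l : ℕ) (hl : ((l + 1 : ℕ) : ℕ∞) ≤ k) (hl' : (l : ℕ∞) ≤ k) (θ : ℝ),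
      HasDerivAt (g ⟨l, hl'⟩) (g ⟨l + 1, hl⟩ θ) θ) :
    ∃ u, jet k u = g := by
  -- The jump of `arg` is harmless because `g 0` is `2π`-periodic.
  let u : Circle → ℂ := fun z => g ⟨0, by simp⟩ (Complex.arg z)
  have hu : lift u = g ⟨0, by simp⟩ := by
    funext θ
    obtain ⟨m, hm⟩ := Circle.exp_eq_exp.1 (Circle.exp_arg (Circle.exp θ))
    simp only [lift, u, hm]
    exact hper.int_mul m θ
  have hD : ∀ (l : ℕ) (hl : (l : ℕ∞) ≤ k), iteratedDeriv l (lift u) = g ⟨l, hl⟩ := by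
    intro l
    induction l with
    | zero => intro hl; rw [iteratedDeriv_zero, hu]
    | succ l ih =>
      intro hl
      have hl' : (l : ℕ∞) ≤ k := le_trans (by exact_mod_cast Nat.le_succ l) hl
      rw [iteratedDeriv_succ, ih hl']
      funext θ
      exact (hg l hl hl' θ).deriv
  have hC : ContDiff ℝ k (lift u) := by
    rw [contDiff_iff_iteratedDeriv]
    refine ⟨fun m hm => ?_, fun m hm => ?_⟩
    · rw [hD m hm]; exact (g _).continuous
    · rw [hD m hm.le]
      intro θ
      exact (hg m (by simpa using Order.add_one_le_of_lt hm) hm.le θ).differentiableAt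
  refine ⟨⟨u, hC⟩, ?_⟩
  funext l
  ext θ
  exact congrFun (hD l.1 l.2) θ

/-- Uniform limits preserve periodicity and the relation that each component is the derivative of
the preceding one; such a compatible family is a jet. -/
theorem isClosed_range_jet (k : ℕ∞) : IsClosed (range (jet k)) := by
  refine IsSeqClosed.isClosed ?_
  intro x g hx hlim
  choose u hu using hx
  obtain rfl : (fun n => jet k (u n)) = x := funext hu
  have hunif : ∀ l : {l : ℕ // (l : ℕ∞) ≤ k},
      TendstoUniformly (fun n => angDeriv l.1 (u n)) (g l) atTop := fun l =>
    BoundedContinuousFunction.tendsto_iff_tendstoUniformly.1 ((tendsto_pi_nhds.1 hlim) l)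
  refine exists_ck_of_hasDerivAt g (fun θ => ?_) (fun l hl hl' θ => ?_)
  · refine tendsto_nhds_unique ((hunif ⟨0, by simp⟩).tendsto_at (θ + 2 * Real.pi)) ?_
    simp only [angDeriv_periodic 0 _ θ]
    exact (hunif ⟨0, by simp⟩).tendsto_at θ
  · exact hasDerivAt_of_tendstoUniformly (hunif ⟨l + 1, hl⟩)
      (Eventually.of_forall fun n θ => hasDerivAt_angDeriv (u n) hl θ)
      (fun θ => (hunif ⟨l, hl'⟩).tendsto_at θ) θ

/-- The jet map is a closed embedding into a countable product of Banach spaces, so complete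
metrizability is inherited. -/
theorem Ck.baireSpace (k : ℕ∞) : BaireSpace (Ck k) := by
  have h : IsClosedEmbedding (jet k) :=
    ⟨⟨isInducing_jet k, injective_jet k⟩, isClosed_range_jet k⟩
  have := h.IsCompletelyPseudoMetrizableSpace
  infer_instance

/-! ### Reflection of the circle -/

/-- The map `u ↦ u(1/z)` on `C^k(T)`. -/
def reflect (k : ℕ∞) : Ck k →ₗ[ℂ] Ck k where
  toFun u := ⟨fun z => u z⁻¹, by
    have h : ContDiff ℝ k fun θ : ℝ => lift u (-θ) := u.contDiff.comp contDiff_neg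
    have h2 : lift (fun z => u z⁻¹) = fun θ : ℝ => lift u (-θ) := by
      funext θ
      simp [lift, Circle.exp_neg]
    change ContDiff ℝ k (lift fun z => u z⁻¹)
    rwa [h2]⟩
  map_add' _ _ := rfl
  map_smul' _ _ := rfl

theorem reflect_apply {k : ℕ∞} (u : Ck k) (z : Circle) : reflect k u z = u z⁻¹ := rfl

theorem reflect_reflect {k : ℕ∞} (u : Ck k) : reflect k (reflect k u) = u :=
  Ck.ext fun z => by simp [reflect_apply]

theorem angDeriv_reflect {k : ℕ∞} (l : ℕ) (u : Ck k) (θ : ℝ) :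
    angDeriv l (reflect k u) θ = (-1) ^ l • angDeriv l u (-θ) := by
  have h2 : lift (reflect k u) = fun θ : ℝ => lift u (-θ) := by
    funext θ
    simp [lift, reflect_apply, Circle.exp_neg]
  unfold angDeriv
  rw [h2, iteratedDeriv_comp_neg]
  simp

theorem continuous_reflect (k : ℕ∞) : Continuous (reflect k) := by
  refine (withSeminorms k).continuous_of_continuous_comp (reflect k) fun l => ?_
  have : ((ckSeminormFamily k l).comp (reflect k) : Ck k → ℝ) = ckSeminormFamily k l := by
    funext u
    rw [Seminorm.comp_apply, ckSeminorm_apply, ckSeminorm_apply]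
    simp only [angDeriv_reflect, norm_smul, norm_pow, norm_neg, norm_one, one_pow, one_mul]
    exact (Equiv.neg ℝ).iSup_comp (g := fun θ => ‖angDeriv l.1 u θ‖)
  rw [this]
  exact (withSeminorms k).continuous_seminorm l

/-- The map `u ↦ u(1/z)` as a homeomorphism. -/
def reflectHomeomorph (k : ℕ∞) : Ck k ≃ₜ Ck k where
  toFun := reflect k
  invFun := reflect k
  left_inv := reflect_reflect
  right_inv := reflect_reflect
  continuous_toFun := continuous_reflect k
  continuous_invFun := continuous_reflect k

/-! ### Classes of bounded extensions and the category argument -/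

/-- The functions with a holomorphic extension to `P(z₀, r)`, continuous up to `D(z₀, r) ∩ T`. -/
def innerExtSubmodule (k : ℕ∞) (z₀ : Circle) (r : ℝ) : Submodule ℂ (Ck k) where
  carrier := {u | ∃ F, IsInnerExt F u z₀ r}
  add_mem' := by
    rintro u v ⟨F, hF⟩ ⟨G, hG⟩
    refine ⟨fun z => F z + G z, hF.1.add hG.1, hF.2.1.add hG.2.1, fun z hz => ?_⟩
    change F z + G z = u z + v z
    rw [hF.2.2 z hz, hG.2.2 z hz]
  zero_mem' := ⟨fun _ => 0, continuousOn_const, differentiableOn_const _, fun _ _ => rfl⟩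
  smul_mem' := by
    rintro c u ⟨F, hF⟩
    refine ⟨fun z => c * F z, hF.1.const_mul c, hF.2.1.const_mul c, fun z hz => ?_⟩
    change c * F z = c * u z
    rw [hF.2.2 z hz]

theorem innerExtSubmodule_ne_top (k : ℕ∞) (z₀ : Circle) {r : ℝ} (hr : 0 < r) :
    innerExtSubmodule k z₀ r ≠ ⊤ := by
  intro h
  obtain ⟨p, hp⟩ := innerPart_nonempty z₀ hr
  have hc : ContDiff ℝ k (lift fun z => ((z : ℂ) - p)⁻¹) := by
    have h1 : ContDiff ℝ k fun θ : ℝ => Complex.exp (θ * Complex.I) - p :=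
      ((Complex.ofRealCLM.contDiff.mul contDiff_const).cexp).sub contDiff_const
    refine h1.inv fun θ h0 => ?_
    have h2 : ‖p‖ < 1 := hp.2
    rw [← sub_eq_zero.1 h0, Complex.norm_exp_ofReal_mul_I] at h2
    exact lt_irrefl _ h2
  have hmem : (show Ck k from ⟨_, hc⟩) ∈ innerExtSubmodule k z₀ r := by
    rw [h]
    exact Submodule.mem_top
  obtain ⟨F, hF⟩ := hmem
  exact not_isInnerExt_inv_sub hr hp hF

/-- The functions with an extension to `P(z₀, r)` bounded by `M`. -/
def bddInnerExt (k : ℕ∞) (z₀ : Circle) (r M : ℝ) : Set (Ck k) :=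
  {u | ∃ F, IsInnerExt F u z₀ r ∧ ∀ z ∈ closedPart z₀ r, ‖F z‖ ≤ M}

/-- The functions with an extension to `D(z₀, r)` bounded by `M`. -/
def bddDiscExt (k : ℕ∞) (z₀ : Circle) (r M : ℝ) : Set (Ck k) :=
  {u | ∃ F, IsDiscExt F u z₀ r ∧ ∀ z ∈ ball (z₀ : ℂ) r, ‖F z‖ ≤ M}

theorem closure_bddInnerExt_subset (k : ℕ∞) (z₀ : Circle) {r : ℝ} (M : ℝ) (hr : 0 < r) :
    closure (bddInnerExt k z₀ r M) ⊆ innerExtSubmodule k z₀ (shrink r) := by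
  intro u hu
  refine exists_isInnerExt_of_approx (M := M) hr fun ε hε => ?_
  obtain ⟨v, ⟨F, hF, hM⟩, hv⟩ := exists_mem_forall_norm_sub_le hu hε
  exact ⟨v, F, hF, hM, hv⟩

theorem closure_bddDiscExt_subset (k : ℕ∞) (z₀ : Circle) {r : ℝ} (M : ℝ) (hr : 0 < r)
    (hr' : r ≤ 1 / 2) : closure (bddDiscExt k z₀ (2 * r) M) ⊆ {u | ExtendsToDisc u z₀} := by
  intro u hu
  refine ⟨shrink r, shrink_pos hr, exists_isDiscExt_of_approx (M := M) hr hr' fun ε hε => ?_⟩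
  obtain ⟨v, ⟨F, hF, hM⟩, hv⟩ := exists_mem_forall_norm_sub_le hu hε
  exact ⟨v, F, hF, hM, hv⟩

/-- The radii of a countable neighbourhood basis. -/
def radius (m : ℕ) : ℝ := 1 / 2 / ((m : ℝ) + 1)

theorem radius_pos (m : ℕ) : 0 < radius m := by unfold radius; positivity

theorem radius_le (m : ℕ) : radius m ≤ 1 / 2 :=
  div_le_self (by norm_num) (by linarith [m.cast_nonneg (α := ℝ)])

theorem exists_denseSeq_ball_subset (z₀ : Circle) {r : ℝ} (hr : 0 < r) :
    ∃ n m : ℕ, ball (TopologicalSpace.denseSeq Circle n : ℂ) (2 * radius m) ⊆ ball (z₀ : ℂ) r := by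
  obtain ⟨m, hm⟩ := exists_nat_one_div_lt (show 0 < r / 2 by positivity)
  have hm' : 2 * radius m < r / 2 := by
    rwa [show 2 * radius m = 1 / ((m : ℝ) + 1) by unfold radius; ring]
  obtain ⟨n, hn⟩ := (TopologicalSpace.denseRange_denseSeq Circle).exists_dist_lt z₀
    (half_pos hr)
  refine ⟨n, m, ball_subset_ball' ?_⟩
  have : dist (TopologicalSpace.denseSeq Circle n : ℂ) z₀ < r / 2 := by
    rw [dist_comm]; exact hn
  linarith

theorem ball_radius_subset (z : ℂ) (m : ℕ) : ball z (radius m) ⊆ ball z (2 * radius m) :=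
  ball_subset_ball (by linarith [radius_pos m])

/-- The bounded classes need not be shown closed: every element of their closures still extends, on
a smaller radius, so removing the closures removes nothing from `U3`. -/
theorem U3_eq (k : ℕ∞) : U3 k = ⋂ p : ℕ × ℕ × ℕ,
    (closure (bddInnerExt k (TopologicalSpace.denseSeq Circle p.1) (radius p.2.1) p.2.2))ᶜ := by
  refine Subset.antisymm ?_ ?_
  · intro u hu
    refine mem_iInter.2 fun p hp => ?_
    obtain ⟨F, hF⟩ := closure_bddInnerExt_subset k _ _ (radius_pos p.2.1) hp
    exact mem_iInter.1 hu (TopologicalSpace.denseSeq Circle p.1)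
      (extendsInside_iff.2 ⟨_, shrink_pos (radius_pos _), F, hF⟩)
  · intro u hu
    refine mem_iInter.2 fun z₀ hz₀ => ?_
    obtain ⟨r, hr, F, hF⟩ := extendsInside_iff.1 hz₀
    -- `F` may be unbounded on `P(z₀, r)`; compactness gives a bound at half the radius.
    obtain ⟨M, hM⟩ := ((isCompact_closedBall (0 : ℂ) 1).inter_right
      (isClosed_closedBall (x := (z₀ : ℂ)) (ε := r / 2))).exists_bound_of_continuousOn
      (hF.1.mono (inter_subset_inter_right _ (closedBall_subset_ball (half_lt_self hr))))
    obtain ⟨N, hN⟩ := exists_nat_ge M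
    obtain ⟨n, m, hnm⟩ := exists_denseSeq_ball_subset z₀ (half_pos hr)
    replace hnm := (ball_radius_subset _ m).trans hnm
    refine mem_iInter.1 hu (n, m, N) (subset_closure ⟨F, hF.mono (hnm.trans
      (ball_subset_ball (by linarith))), fun z hz => (hM z ?_).trans hN⟩)
    exact ⟨hz.1, ball_subset_closedBall (hnm hz.2)⟩

theorem U5_eq (k : ℕ∞) : U5 k = ⋂ p : ℕ × ℕ × ℕ,
    (closure (bddDiscExt k (TopologicalSpace.denseSeq Circle p.1) (2 * radius p.2.1) p.2.2))ᶜ := by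
  refine Subset.antisymm ?_ ?_
  · intro u hu
    refine mem_iInter.2 fun p hp => ?_
    exact mem_iInter.1 hu (TopologicalSpace.denseSeq Circle p.1)
      (closure_bddDiscExt_subset k _ _ (radius_pos p.2.1) (radius_le _) hp)
  · intro u hu
    refine mem_iInter.2 fun z₀ hz₀ => ?_
    obtain ⟨r, hr, F, hF⟩ := hz₀
    obtain ⟨M, hM⟩ := (isCompact_closedBall (z₀ : ℂ) (r / 2)).exists_bound_of_continuousOn
      (hF.1.continuousOn.mono (closedBall_subset_ball (half_lt_self hr)))
    obtain ⟨N, hN⟩ := exists_nat_ge M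
    obtain ⟨n, m, hnm⟩ := exists_denseSeq_ball_subset z₀ (half_pos hr)
    refine mem_iInter.1 hu (n, m, N) (subset_closure ⟨F, IsDiscExt.mono hF (hnm.trans
      (ball_subset_ball (by linarith))), fun z hz => (hM z ?_).trans hN⟩)
    exact ball_subset_closedBall (hnm hz)

theorem isGδ_U3 (k : ℕ∞) : IsGδ (U3 k) := by
  rw [U3_eq]
  exact IsGδ.iInter_of_isOpen fun p => isClosed_closure.isOpen_compl

theorem isGδ_U5 (k : ℕ∞) : IsGδ (U5 k) := by
  rw [U5_eq]
  exact IsGδ.iInter_of_isOpen fun p => isClosed_closure.isOpen_compl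

theorem dense_U3 (k : ℕ∞) : Dense (U3 k) := by
  have := Ck.baireSpace k
  have := Ck.isTopologicalAddGroup k
  have := Ck.continuousSMul k
  rw [U3_eq]
  refine dense_iInter_of_isOpen (fun p => isClosed_closure.isOpen_compl) fun p => ?_
  rw [← interior_eq_empty_iff_dense_compl]
  by_contra hne
  -- A linear subspace with nonempty interior is the whole space.
  refine innerExtSubmodule_ne_top k (TopologicalSpace.denseSeq Circle p.1)
    (shrink_pos (radius_pos p.2.1)) (Submodule.eq_top_of_nonempty_interior' _ ?_)
  exact (nonempty_iff_ne_empty.2 hne).mono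
    (interior_mono (closure_bddInnerExt_subset k _ _ (radius_pos _)))

/-! ### Inversion and the exterior side -/

theorem dist_inv_circle {z₀ : Circle} {w : ℂ} (hw : w ≠ 0) :
    ‖w⁻¹ - (z₀⁻¹ : Circle)‖ = ‖w - z₀‖ / ‖w‖ := by
  have := Circle.coe_ne_zero z₀
  have h : w⁻¹ - (z₀⁻¹ : Circle) = (z₀ - w) / (w * z₀) := by
    rw [Circle.coe_inv]; field_simp
  rw [h, norm_div, norm_mul, Circle.norm_coe, mul_one, norm_sub_rev]

/-- Inversion maps a small disc about `z₀` into a given disc about `1 / z₀`. -/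
theorem inv_mem_ball {z₀ : Circle} {r : ℝ} {w : ℂ}
    (hw : w ∈ ball (z₀ : ℂ) (min (r / 2) (1 / 2))) :
    w ≠ 0 ∧ w⁻¹ ∈ ball ((z₀⁻¹ : Circle) : ℂ) r := by
  have h2 := half_lt_norm (min_le_right _ _) hw
  have h0 : w ≠ 0 := fun h0 => by rw [h0, norm_zero] at h2; linarith
  refine ⟨h0, ?_⟩
  have h3 := ball_subset_ball (min_le_left _ _) hw
  rw [mem_ball, dist_eq_norm] at h3 ⊢
  rw [dist_inv_circle h0, div_lt_iff₀ (by linarith)]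
  have hr : 0 < r := by linarith [norm_nonneg (w - z₀)]
  nlinarith

/-- Extensions on one side of the circle are carried to the other side by inversion. -/
theorem exists_extension_inv {A B : ℝ → Set ℂ} {z₀ : Circle} {u : Circle → ℂ}
    (hA : ∀ r, A r ⊆ ball (z₀ : ℂ) r)
    (hAB : ∀ r s w, w ∈ A r → w ≠ 0 → w⁻¹ ∈ ball ((z₀⁻¹ : Circle) : ℂ) s → w⁻¹ ∈ B s)
    (h : ∃ r : ℝ, 0 < r ∧ ∃ F : ℂ → ℂ, ContinuousOn F (T ∪ B r) ∧
      DifferentiableOn ℂ F (B r) ∧ AgreeNear F u z₀⁻¹ r) :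
    ∃ r : ℝ, 0 < r ∧ ∃ F : ℂ → ℂ, ContinuousOn F (T ∪ A r) ∧
      DifferentiableOn ℂ F (A r) ∧ AgreeNear F (fun z => u z⁻¹) z₀ r := by
  obtain ⟨r, hr, F, hFc, hFd, hFu⟩ := h
  have hmaps : MapsTo (fun w : ℂ => w⁻¹) (A (min (r / 2) (1 / 2))) (B r) := fun w hw =>
    hAB _ _ w hw (inv_mem_ball (hA _ hw)).1 (inv_mem_ball (hA _ hw)).2
  have hne : ∀ w ∈ A (min (r / 2) (1 / 2)), w ≠ 0 := fun w hw => (inv_mem_ball (hA _ hw)).1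
  refine ⟨min (r / 2) (1 / 2), lt_min (half_pos hr) (by norm_num), fun w => F w⁻¹,
    hFc.comp (continuousOn_id.inv₀ ?_) ?_, hFd.comp (differentiableOn_id.inv hne) hmaps, ?_⟩
  · rintro w (hw | hw)
    · exact ne_of_mem_sphere hw one_ne_zero
    · exact hne w hw
  · rintro w (hw | hw)
    · left
      rw [T, mem_sphere_zero_iff_norm] at hw ⊢
      simp [hw]
    · exact Or.inr (hmaps hw)
  · intro z hz
    have := hFu z⁻¹ (by simpa using (inv_mem_ball hz).2)
    simpa using this

theorem extendsOutside_iff_reflect {k : ℕ∞} {u : Ck k} {z₀ : Circle} :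
    ExtendsOutside u z₀ ↔ ExtendsInside (reflect k u) z₀⁻¹ := by
  constructor
  · intro h
    refine exists_extension_inv (A := innerPart z₀⁻¹) (B := outerPart z₀)
      (fun r => inter_subset_left) (fun r s w hw hw0 hws => ⟨by rwa [inv_inv] at hws, ?_⟩)
      (by rw [inv_inv]; exact h)
    change 1 < ‖w⁻¹‖
    rw [norm_inv]
    exact (one_lt_inv₀ (norm_pos_iff.2 hw0)).2 hw.2
  · intro h
    have h2 := exists_extension_inv (u := reflect k u) (A := outerPart z₀) (B := innerPart z₀⁻¹)
      (fun r => inter_subset_left) (fun r s w hw _ hws => ⟨hws, ?_⟩) h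
    · simp only [reflect_apply, inv_inv] at h2
      exact h2
    · change ‖w⁻¹‖ < 1
      rw [norm_inv]
      exact inv_lt_one_of_one_lt₀ hw.2

theorem U2_eq_preimage (k : ℕ∞) : U2 k = reflectHomeomorph k ⁻¹' U3 k := by
  ext u
  simp only [U2, U3, U2At, U3At, mem_iInter, mem_preimage]
  constructor
  · intro h z hz
    exact h z⁻¹ (extendsOutside_iff_reflect.2 (by rw [inv_inv]; exact hz))
  · intro h z hz
    exact h z⁻¹ (extendsOutside_iff_reflect.1 hz)

theorem isGδ_U2 (k : ℕ∞) : IsGδ (U2 k) := by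
  rw [U2_eq_preimage]
  exact (isGδ_U3 k).preimage (reflectHomeomorph k).continuous

theorem dense_U2 (k : ℕ∞) : Dense (U2 k) := by
  rw [U2_eq_preimage]
  exact (dense_U3 k).preimage (reflectHomeomorph k).isOpenMap

theorem U4_eq_inter (k : ℕ∞) : U4 k = U2 k ∩ U3 k := by
  rw [U2, U3, ← iInter_inter_distrib]
  rfl

theorem U3_subset_U5 (k : ℕ∞) : U3 k ⊆ U5 k :=
  iInter_mono fun _ _ hu h => hu h.extendsInside

end CircleExtension
end

theorem theorem3p18 (k : ℕ∞) :
    (Dense (CircleExtension.U2 k) ∧ IsGδ (CircleExtension.U2 k)) ∧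
    (Dense (CircleExtension.U3 k) ∧ IsGδ (CircleExtension.U3 k)) ∧
    (Dense (CircleExtension.U4 k) ∧ IsGδ (CircleExtension.U4 k)) ∧
    (Dense (CircleExtension.U5 k) ∧ IsGδ (CircleExtension.U5 k)) := by
  have := CircleExtension.Ck.baireSpace k
  have hG2 := CircleExtension.isGδ_U2 k
  have hG3 := CircleExtension.isGδ_U3 k
  have hD2 := CircleExtension.dense_U2 k
  have hD3 := CircleExtension.dense_U3 k
  refine ⟨⟨hD2, hG2⟩, ⟨hD3, hG3⟩, ?_,
    hD3.mono (CircleExtension.U3_subset_U5 k), CircleExtension.isGδ_U5 k⟩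
  rw [CircleExtension.U4_eq_inter]
  -- Density of the intersection uses the Baire property again.
  exact ⟨hD2.inter_of_Gδ hG2 hG3 hD3, hG2.inter hG3⟩
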